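/- **Lemma (Antoine–Speiser).** Let $\mathfrak g=\mathfrak{sl}_3(\mathbb C)$, let $\mathfrak h\subset\mathfrak g$ be the Cartan subalgebra of diagonal matrices, let $\varepsilon_i\in\mathfrak h^*$ be $\varepsilon_i(H)=H_{ii}$, let $\alpha_1=\varepsilon_1-\varepsilon_2$, $\alpha_2=\varepsilon_2-\varepsilon_3$ be the simple roots, and let $\omega_1=\tfrac23\alpha_1+\tfrac13\alpha_2$, $\omega_2=\tfrac13\alpha_1+\tfrac23\alpha_2$ be the fundamental dominant weights. Let $\lambda=a\omega_1+b\omega_2$ and $\varphi=x\omega_1+y\omega_2$ be dominant integral weights ($a,b,x,y$ nonnegative integers), and suppose that $a+2b-x-2y$ is divisible by $3$. Then $\lambda-\varphi$ lies in the root lattice $\mathbb Z\alpha_1+\mathbb Z\alpha_2$, and if $V(\lambda)$ is an irreducible finite-dimensional $\mathfrak g$-module with highest weight $\lambda$, then the multiplicity of $\varphi$ in $V(\lambda)$, that is, the dimension of the weight space $V(\lambda)_\varphi=\{v: Hv=\varphi(H)v \text{ for all } H\in\mathfrak h\}$, is $$m_\lambda(\varphi)=\max\Bigl\{0,\ \min\Bigl\{\tfrac13(a+2b-x-2y)+1,\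 \tfrac13(2a+b-2x-y)+1,\ a+1,\ b+1\Bigr\}\Bigr\}.$$ -/

import Mathlib

open scoped Matrix

attribute [local instance 100] LieRing.ofAssociativeRing

noncomputable section

namespace TypeA2

/-- The Lie algebra `𝔤 = 𝔰𝔩₃(ℂ)` of traceless complex `3 × 3` matrices. -/
abbrev sl3 : LieSubalgebra ℂ (Matrix (Fin 3) (Fin 3) ℂ) :=
  LieAlgebra.SpecialLinear.sl (Fin 3) ℂ

/-- The Cartan subalgebra `𝔥` of diagonal matrices in `𝔰𝔩₃(ℂ)`. -/
def cartan : LieSubalgebra ℂ sl3 where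
  carrier := {A | A.val.IsDiag}
  add_mem' {A B} hA hB := Matrix.IsDiag.add hA hB
  zero_mem' := Matrix.isDiag_zero
  smul_mem' c A hA := Matrix.IsDiag.smul c hA
  lie_mem' {A B} hA hB := by
    have key : (⁅A, B⁆ : sl3).val = 0 := by
      rw [LieAlgebra.SpecialLinear.sl_bracket, ← Matrix.IsDiag.diagonal_diag hA,
        ← Matrix.IsDiag.diagonal_diag hB]
      simp [Matrix.diagonal_mul_diagonal, mul_comm]
    change (⁅A, B⁆ : sl3).val.IsDiag
    rw [key]
    exact Matrix.isDiag_zero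

/-- The Cartan subalgebra is abelian; this makes Mathlib's weight spaces available for it. -/
instance : IsLieAbelian cartan where
  trivial A B := by
    apply Subtype.ext
    apply Subtype.ext
    change (⁅A.val, B.val⁆ : sl3).val = 0
    have hA : A.val.val.IsDiag := A.2
    have hB : B.val.val.IsDiag := B.2
    rw [LieAlgebra.SpecialLinear.sl_bracket, ← Matrix.IsDiag.diagonal_diag hA,
      ← Matrix.IsDiag.diagonal_diag hB]
    simp [Matrix.diagonal_mul_diagonal, mul_comm]

/-- The linear form `εᵢ : 𝔥 → ℂ`, `εᵢ(H) = Hᵢᵢ`. -/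
def ε (i : Fin 3) : Module.Dual ℂ cartan where
  toFun H := H.val.val i i
  map_add' _ _ := rfl
  map_smul' _ _ := rfl

/-- The simple root `α₁ = ε₁ - ε₂` (matrix indices are `0, 1, 2` here). -/
def α₁ : Module.Dual ℂ cartan := ε 0 - ε 1

/-- The simple root `α₂ = ε₂ - ε₃`. -/
def α₂ : Module.Dual ℂ cartan := ε 1 - ε 2

/-- The fundamental dominant weight `ω₁`. -/
def ω₁ : Module.Dual ℂ cartan := (2 / 3 : ℂ) • α₁ + (1 / 3 : ℂ) • α₂

/-- The fundamental dominant weight `ω₂`. -/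
def ω₂ : Module.Dual ℂ cartan := (1 / 3 : ℂ) • α₁ + (2 / 3 : ℂ) • α₂

/-- The dominant integral weight `(a, b) = a ω₁ + b ω₂`. -/
def wt (a b : ℕ) : Module.Dual ℂ cartan := a • ω₁ + b • ω₂

/-- The root lattice `ℤα₁ + ℤα₂`. -/
def rootLattice : AddSubgroup (Module.Dual ℂ cartan) := AddSubgroup.closure {α₁, α₂}

variable (V : Type*) [AddCommGroup V] [Module ℂ V] [LieRingModule sl3 V] [LieModule ℂ sl3 V]

/-- `V` has a highest weight vector of weight `χ`: a nonzero vector of weight `χ` annihilated by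
the positive root vectors `Eᵢⱼ`, `i < j`. For irreducible finite-dimensional `V` this says that
`V` is the irreducible module with highest weight `χ`. -/
def HasHighestWeight (χ : Module.Dual ℂ cartan) : Prop :=
  ∃ v : V, v ≠ 0 ∧ v ∈ LieModule.weightSpace V (χ : cartan → ℂ) ∧
    ∀ (i j : Fin 3) (hij : i < j), ⁅LieAlgebra.SpecialLinear.single i j hij.ne (1 : ℂ), v⁆ = 0

/-- The multiplicity of the weight `χ` in `V`: the dimension of the weight space
`V_χ = {v | H v = χ(H) v for all H ∈ 𝔥}`. -/
def multiplicity (χ : Module.Dual ℂ cartan) : ℕ :=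
  Module.finrank ℂ (LieModule.weightSpace V (χ : cartan → ℂ))

end TypeA2

end

/-!
The multiplicities are read off from a Gelfand–Tsetlin basis built inside `V` by restricting to
the copy of `𝔤𝔩₂` in `𝔰𝔩₃` whose root is `α₁`.

The Mickelsson operator `Z = f₃ (h₁ + 1) - f₁ f₂` lowers weights by `α₁ + α₂`, preserves the
kernel of `e₁` on weight vectors (`e₁_lowering`) and commutes with `f₂` (`lowering_f₂`). Hence for
a highest weight vector `v` of weight `a ω₁ + b ω₂` the vectors `f₂ ^ j Z ^ k v` are killed by
`e₁`, with `h₁`-eigenvalue `a + j - k`. The action of `e₂` on them is computed in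
`IsHighest.e₂_gtTop`; its coefficients show by induction on `k` that these vectors are nonzero for
`j ≤ b` and `k ≤ a`, while `𝔰𝔩₂`-theory for the two simple roots shows that they vanish otherwise.
Applying powers of `f₁` gives the vectors `f₁ ^ i f₂ ^ j Z ^ k v`, nonzero exactly when also `i ≤
a + j - k`.

The span of these vectors is stable under the Chevalley generators, so by irreducibility it is all
of `V` (`IsHighest.gtSpan_eq_top`). No Poincaré–Birkhoff–Witt argument is needed. They are joint
eigenvectors of `h₁`, `h₂` and `f₁ e₁` with distinct systems of eigenvalues, so the nonzero ones
form a basis. The multiplicity of the weight lower than the highest one by `p α₁ + q α₂` is thus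
the number of `(i, j, k)` with `i + k = p`, `j + k = q`, `j ≤ b`, `k ≤ a` and `i + k ≤ a + j`. For
a dominant weight this is the number of integers `k` in the interval from `max 0 (q - b)` to `min
a p q`, and dominance turns its length into the stated formula (`ncard_gtPatterns`).
-/

noncomputable section

namespace TypeA2

open LieAlgebra.SpecialLinear (single)
open LieModule (toEnd)

/-! ### Chevalley generators of `𝔰𝔩₃` and their relations -/

/-- The simple root vector `E₁₂`. -/
def e₁ : sl3 := single 0 1 (by decide) 1

/-- The simple root vector `E₂₃`. -/
def e₂ : sl3 := single 1 2 (by decide) 1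

/-- The negative simple root vector `E₂₁`. -/
def f₁ : sl3 := single 1 0 (by decide) 1

/-- The negative simple root vector `E₃₂`. -/
def f₂ : sl3 := single 2 1 (by decide) 1

/-- The root vector `⁅f₁, f₂⁆ = -E₃₁` of the root `-(α₁ + α₂)`. -/
def f₃ : sl3 := ⁅f₁, f₂⁆

/-- The coroot of `α₁`, the matrix `diag(1, -1, 0)`. -/
def h₁ : sl3 := ⁅e₁, f₁⁆

/-- The coroot of `α₂`, the matrix `diag(0, 1, -1)`. -/
def h₂ : sl3 := ⁅e₂, f₂⁆

lemma lie_e₁_f₂ : ⁅e₁, f₂⁆ = 0 := by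
  ext i j
  fin_cases i <;> fin_cases j <;> simp [e₁, f₂, Ring.lie_def, Matrix.mul_apply, Matrix.single]

lemma lie_e₂_f₁ : ⁅e₂, f₁⁆ = 0 := by
  ext i j
  fin_cases i <;> fin_cases j <;> simp [e₂, f₁, Ring.lie_def, Matrix.mul_apply, Matrix.single]

lemma val_h₁ : h₁.val = Matrix.diagonal ![1, -1, 0] := by
  ext i j
  fin_cases i <;> fin_cases j <;> simp [h₁, e₁, f₁, Ring.lie_def, Matrix.mul_apply, Matrix.single]

lemma val_h₂ : h₂.val = Matrix.diagonal ![0, 1, -1] := by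
  ext i j
  fin_cases i <;> fin_cases j <;> simp [h₂, e₂, f₂, Ring.lie_def, Matrix.mul_apply, Matrix.single]

lemma lie_h₁_e₁ : ⁅h₁, e₁⁆ = 2 • e₁ := by
  ext i j
  fin_cases i <;> fin_cases j <;>
    simp [val_h₁, e₁, Ring.lie_def, Matrix.mul_apply, Matrix.single, two_smul, one_add_one_eq_two]

lemma lie_h₁_f₁ : ⁅h₁, f₁⁆ = -(2 • f₁) := by
  ext i j
  fin_cases i <;> fin_cases j <;>
    simp [val_h₁, f₁, Ring.lie_def, Matrix.mul_apply, Matrix.single, two_smul]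
  norm_num

lemma lie_h₁_f₂ : ⁅h₁, f₂⁆ = f₂ := by
  ext i j
  fin_cases i <;> fin_cases j <;>
    simp [val_h₁, f₂, Ring.lie_def, Matrix.mul_apply, Matrix.single]

lemma lie_h₂_e₂ : ⁅h₂, e₂⁆ = 2 • e₂ := by
  ext i j
  fin_cases i <;> fin_cases j <;>
    simp [val_h₂, e₂, Ring.lie_def, Matrix.mul_apply, Matrix.single, two_smul, one_add_one_eq_two]

lemma lie_h₂_f₂ : ⁅h₂, f₂⁆ = -(2 • f₂) := by
  ext i j
  fin_cases i <;> fin_cases j <;>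
    simp [val_h₂, f₂, Ring.lie_def, Matrix.mul_apply, Matrix.single, two_smul]
  norm_num

lemma lie_h₂_f₁ : ⁅h₂, f₁⁆ = f₁ := by
  ext i j
  fin_cases i <;> fin_cases j <;>
    simp [val_h₂, f₁, Ring.lie_def, Matrix.mul_apply, Matrix.single]

lemma val_f₃ : f₃.val = Matrix.single 2 0 (-1) := by
  ext i j
  fin_cases i <;> fin_cases j <;> simp [f₃, f₁, f₂, Ring.lie_def, Matrix.mul_apply, Matrix.single]

lemma lie_f₁_f₃ : ⁅f₁, f₃⁆ = 0 := by
  ext i j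
  fin_cases i <;> fin_cases j <;> simp [val_f₃, f₁, Ring.lie_def, Matrix.mul_apply, Matrix.single]

lemma lie_f₂_f₃ : ⁅f₂, f₃⁆ = 0 := by
  ext i j
  fin_cases i <;> fin_cases j <;> simp [val_f₃, f₂, Ring.lie_def, Matrix.mul_apply, Matrix.single]

lemma isSl2Triple₁ : IsSl2Triple h₁ e₁ f₁ where
  h_ne_zero h := by simpa [val_h₁] using congrFun₂ (congrArg Subtype.val h) 0 0
  lie_e_f := rfl
  lie_h_e_nsmul := lie_h₁_e₁
  lie_h_f_nsmul := lie_h₁_f₁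

lemma isSl2Triple₂ : IsSl2Triple h₂ e₂ f₂ where
  h_ne_zero h := by simpa [val_h₂] using congrFun₂ (congrArg Subtype.val h) 1 1
  lie_e_f := rfl
  lie_h_e_nsmul := lie_h₂_e₂
  lie_h_f_nsmul := lie_h₂_f₂

/-- A traceless matrix in terms of the Chevalley generators. -/
lemma eq_chevalley (X : sl3) :
    X = X.val 0 1 • e₁ + X.val 1 2 • e₂ + X.val 0 2 • ⁅e₁, e₂⁆ + X.val 1 0 • f₁ + X.val 2 1 • f₂
      - X.val 2 0 • f₃ + X.val 0 0 • h₁ + (X.val 0 0 + X.val 1 1) • h₂ := by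
  have htr : X.val 2 2 = -(X.val 0 0 + X.val 1 1) := by
    have h : Matrix.trace X.val = 0 := X.2
    rw [Matrix.trace_fin_three] at h
    linear_combination h
  ext i j
  fin_cases i <;> fin_cases j <;>
    simp [val_h₁, val_h₂, val_f₃, e₁, e₂, f₁, f₂, Ring.lie_def, Matrix.mul_apply,
      Matrix.single, htr]

lemma h₁_mem_cartan : h₁ ∈ cartan := by
  change h₁.val.IsDiag
  rw [val_h₁]
  exact Matrix.isDiag_diagonal _

lemma h₂_mem_cartan : h₂ ∈ cartan := by
  change h₂.val.IsDiag
  rw [val_h₂]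
  exact Matrix.isDiag_diagonal _

lemma cartan_eq (H : cartan) :
    H.val = ε 0 H • h₁ + (ε 0 H + ε 1 H) • h₂ := by
  have hd : H.val.val.IsDiag := H.2
  have h := eq_chevalley H.val
  rw [hd (show (0 : Fin 3) ≠ 1 by decide), hd (show (1 : Fin 3) ≠ 2 by decide),
    hd (show (0 : Fin 3) ≠ 2 by decide), hd (show (1 : Fin 3) ≠ 0 by decide),
    hd (show (2 : Fin 3) ≠ 1 by decide), hd (show (2 : Fin 3) ≠ 0 by decide)] at h
  simp only [zero_smul, zero_add, add_zero, sub_zero] at h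
  exact h

lemma ε_two (H : cartan) : ε 2 H = -(ε 0 H + ε 1 H) := by
  have h : Matrix.trace H.val.val = 0 := H.val.2
  rw [Matrix.trace_fin_three] at h
  change H.val.val 2 2 = -(H.val.val 0 0 + H.val.val 1 1)
  linear_combination h

lemma wt_apply (a b : ℕ) (H : cartan) :
    wt a b H = a * ε 0 H + b * (ε 0 H + ε 1 H) := by
  simp only [wt, ω₁, ω₂, α₁, α₂, LinearMap.add_apply, LinearMap.smul_apply, LinearMap.sub_apply,
    smul_eq_mul, nsmul_eq_mul, ε_two]
  ring

lemma ε_zero_h₁ : ε 0 ⟨h₁, h₁_mem_cartan⟩ = 1 := by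
  change h₁.val 0 0 = 1
  simp [val_h₁]

lemma ε_one_h₁ : ε 1 ⟨h₁, h₁_mem_cartan⟩ = -1 := by
  change h₁.val 1 1 = -1
  simp [val_h₁]

lemma ε_zero_h₂ : ε 0 ⟨h₂, h₂_mem_cartan⟩ = 0 := by
  change h₂.val 0 0 = 0
  simp [val_h₂]

lemma ε_one_h₂ : ε 1 ⟨h₂, h₂_mem_cartan⟩ = 1 := by
  change h₂.val 1 1 = 1
  simp [val_h₂]

section Module

variable {V : Type*} [AddCommGroup V] [LieRingModule sl3 V]

/-! The relations as identities between actions on a vector, oriented so that rewriting brings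
every word into the order `f₁, f₃, f₂, h, e`; only `f₃_apply` eliminates `f₃` instead. -/

lemma e₁_f₁_apply (u : V) : ⁅e₁, ⁅f₁, u⁆⁆ = ⁅f₁, ⁅e₁, u⁆⁆ + ⁅h₁, u⁆ := by
  rw [leibniz_lie, ← h₁, add_comm]

lemma e₁_f₂_apply (u : V) : ⁅e₁, ⁅f₂, u⁆⁆ = ⁅f₂, ⁅e₁, u⁆⁆ := by
  rw [leibniz_lie, lie_e₁_f₂, zero_lie, zero_add]

lemma e₂_f₁_apply (u : V) : ⁅e₂, ⁅f₁, u⁆⁆ = ⁅f₁, ⁅e₂, u⁆⁆ := by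
  rw [leibniz_lie, lie_e₂_f₁, zero_lie, zero_add]

lemma e₂_f₂_apply (u : V) : ⁅e₂, ⁅f₂, u⁆⁆ = ⁅f₂, ⁅e₂, u⁆⁆ + ⁅h₂, u⁆ := by
  rw [leibniz_lie, ← h₂, add_comm]

lemma h₁_f₂_apply (u : V) : ⁅h₁, ⁅f₂, u⁆⁆ = ⁅f₂, ⁅h₁, u⁆⁆ + ⁅f₂, u⁆ := by
  rw [leibniz_lie, lie_h₁_f₂, add_comm]

lemma h₂_f₁_apply (u : V) : ⁅h₂, ⁅f₁, u⁆⁆ = ⁅f₁, ⁅h₂, u⁆⁆ + ⁅f₁, u⁆ := by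
  rw [leibniz_lie, lie_h₂_f₁, add_comm]

lemma f₂_f₁_apply (u : V) : ⁅f₂, ⁅f₁, u⁆⁆ = ⁅f₁, ⁅f₂, u⁆⁆ - ⁅f₃, u⁆ := by
  rw [f₃, lie_lie]
  abel

lemma f₃_f₁_apply (u : V) : ⁅f₃, ⁅f₁, u⁆⁆ = ⁅f₁, ⁅f₃, u⁆⁆ := by
  rw [leibniz_lie f₁, lie_f₁_f₃, zero_lie, zero_add]

lemma f₂_f₃_apply (u : V) : ⁅f₂, ⁅f₃, u⁆⁆ = ⁅f₃, ⁅f₂, u⁆⁆ := by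
  rw [leibniz_lie, lie_f₂_f₃, zero_lie, zero_add]

lemma f₃_apply (u : V) : ⁅f₃, u⁆ = ⁅f₁, ⁅f₂, u⁆⁆ - ⁅f₂, ⁅f₁, u⁆⁆ := by
  rw [f₃, lie_lie]

lemma e₁_f₃_apply (u : V) : ⁅e₁, ⁅f₃, u⁆⁆ = ⁅f₃, ⁅e₁, u⁆⁆ + ⁅f₂, u⁆ := by
  simp only [f₃_apply, lie_sub, e₁_f₁_apply, e₁_f₂_apply, h₁_f₂_apply, lie_add]
  abel

lemma e₂_f₃_apply (u : V) : ⁅e₂, ⁅f₃, u⁆⁆ = ⁅f₃, ⁅e₂, u⁆⁆ - ⁅f₁, u⁆ := by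
  simp only [f₃_apply, lie_sub, e₂_f₁_apply, e₂_f₂_apply, h₂_f₁_apply, lie_add]
  abel

variable [Module ℂ V]

lemma h₁_f₁_apply (u : V) : ⁅h₁, ⁅f₁, u⁆⁆ = ⁅f₁, ⁅h₁, u⁆⁆ - (2 : ℂ) • ⁅f₁, u⁆ := by
  rw [leibniz_lie, lie_h₁_f₁, neg_lie, nsmul_lie, ofNat_smul_eq_nsmul ℂ]
  abel

lemma h₂_f₂_apply (u : V) : ⁅h₂, ⁅f₂, u⁆⁆ = ⁅f₂, ⁅h₂, u⁆⁆ - (2 : ℂ) • ⁅f₂, u⁆ := by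
  rw [leibniz_lie, lie_h₂_f₂, neg_lie, nsmul_lie, ofNat_smul_eq_nsmul ℂ]
  abel

variable [LieModule ℂ sl3 V]

lemma h₁_f₃_apply (u : V) : ⁅h₁, ⁅f₃, u⁆⁆ = ⁅f₃, ⁅h₁, u⁆⁆ - ⁅f₃, u⁆ := by
  simp only [f₃_apply, lie_sub, h₁_f₁_apply, h₁_f₂_apply, lie_add, lie_smul]
  module

lemma h₂_f₃_apply (u : V) : ⁅h₂, ⁅f₃, u⁆⁆ = ⁅f₃, ⁅h₂, u⁆⁆ - ⁅f₃, u⁆ := by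
  simp only [f₃_apply, lie_sub, h₂_f₁_apply, h₂_f₂_apply, lie_add, lie_smul]
  module

/-- The weight space of weight `a ω₁ + b ω₂` is a joint eigenspace of the two simple coroots. -/
lemma mem_weightSpace_wt {a b : ℕ} {v : V} :
    v ∈ LieModule.weightSpace V (wt a b : cartan → ℂ) ↔
      ⁅h₁, v⁆ = (a : ℂ) • v ∧ ⁅h₂, v⁆ = (b : ℂ) • v := by
  rw [LieModule.mem_weightSpace]
  constructor
  · intro h
    constructor
    · simpa [wt_apply, ε_zero_h₁, ε_one_h₁] using h ⟨h₁, h₁_mem_cartan⟩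
    · simpa [wt_apply, ε_zero_h₂, ε_one_h₂] using h ⟨h₂, h₂_mem_cartan⟩
  · rintro ⟨p, q⟩ H
    change ⁅H.val, v⁆ = _
    rw [cartan_eq H, add_lie, smul_lie, smul_lie, p, q, wt_apply, smul_smul, smul_smul,
      ← add_smul]
    congr 1
    ring

/-! ### The Mickelsson lowering operator -/

/-- The Mickelsson operator `f₃ (h₁ + 1) - f₁ f₂`, which lowers weights by `α₁ + α₂` and, unlike
`f₃`, preserves the kernel of `e₁`. -/
def lowering : Module.End ℂ V :=
  toEnd ℂ sl3 V f₃ * (toEnd ℂ sl3 V h₁ + 1) - toEnd ℂ sl3 V f₁ * toEnd ℂ sl3 V f₂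

lemma lowering_apply (u : V) :
    lowering u = ⁅f₃, ⁅h₁, u⁆⁆ + ⁅f₃, u⁆ - ⁅f₁, ⁅f₂, u⁆⁆ := by
  simp [lowering]

lemma lowering_f₂ (u : V) : lowering ⁅f₂, u⁆ = ⁅f₂, lowering u⁆ := by
  simp only [lowering_apply, lie_add, lie_sub, h₁_f₂_apply, f₂_f₃_apply, f₂_f₁_apply]
  abel

lemma e₁_lowering {u : V} (hu : ⁅e₁, u⁆ = 0) {m : ℂ} (hm : ⁅h₁, u⁆ = m • u) :
    ⁅e₁, lowering u⁆ = 0 := by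
  simp only [lowering_apply, lie_add, lie_sub, e₁_f₁_apply, e₁_f₃_apply, e₁_f₂_apply,
    h₁_f₂_apply, hm, hu, lie_smul, lie_zero]
  module

lemma h₁_lowering {u : V} {m : ℂ} (hm : ⁅h₁, u⁆ = m • u) :
    ⁅h₁, lowering u⁆ = (m - 1) • lowering u := by
  simp only [lowering_apply, lie_add, lie_sub, h₁_f₁_apply, h₁_f₃_apply,
    h₁_f₂_apply, hm, lie_smul]
  module

lemma h₂_lowering {u : V} {n : ℂ} (hn : ⁅h₂, u⁆ = n • u) {m : ℂ} (hm : ⁅h₁, u⁆ = m • u) :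
    ⁅h₂, lowering u⁆ = (n - 1) • lowering u := by
  simp only [lowering_apply, lie_add, lie_sub, h₂_f₁_apply, h₂_f₃_apply,
    h₂_f₂_apply, hn, hm, lie_smul]
  module

lemma lowering_of_h₁_eq {u : V} {m : ℂ} (hm : ⁅h₁, u⁆ = m • u) :
    lowering u = (m + 1) • ⁅f₃, u⁆ - ⁅f₁, ⁅f₂, u⁆⁆ := by
  rw [lowering_apply, hm, lie_smul]
  module

end Module

section HighestWeight

variable {V : Type*} [AddCommGroup V] [Module ℂ V] [LieRingModule sl3 V] [LieModule ℂ sl3 V]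

/-! ### Highest weight vectors for the subalgebra generated by `e₁, f₁` -/

/-- `v` is a highest weight vector of weight `a ω₁ + b ω₂`. -/
structure IsHighest (a b : ℕ) (v : V) : Prop where
  ne_zero : v ≠ 0
  e₁_eq : ⁅e₁, v⁆ = 0
  e₂_eq : ⁅e₂, v⁆ = 0
  h₁_eq : ⁅h₁, v⁆ = (a : ℂ) • v
  h₂_eq : ⁅h₂, v⁆ = (b : ℂ) • v

/-- The vector `f₂ ^ j Z ^ k v`, where `Z` is the Mickelsson operator. For a highest weight vector
`v` these are the highest weight vectors of the constituents of the restriction to `𝔤𝔩₂`. -/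
def gtTop (v : V) (j k : ℕ) : V := (toEnd ℂ sl3 V f₂ ^ j) ((lowering ^ k) v)

lemma gtTop_zero_zero (v : V) : gtTop v 0 0 = v := rfl

lemma gtTop_succ_left (v : V) (j k : ℕ) : gtTop v (j + 1) k = ⁅f₂, gtTop v j k⁆ := by
  rw [gtTop, pow_succ']
  rfl

lemma commute_lowering_f₂ : Commute (lowering : Module.End ℂ V) (toEnd ℂ sl3 V f₂) :=
  LinearMap.ext fun u ↦ lowering_f₂ u

lemma gtTop_eq (v : V) (j k : ℕ) :
    gtTop v j k = (lowering ^ k) ((toEnd ℂ sl3 V f₂ ^ j) v) :=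
  (LinearMap.congr_fun (commute_lowering_f₂.pow_pow k j).eq v).symm

lemma gtTop_succ_right (v : V) (j k : ℕ) : gtTop v j (k + 1) = lowering (gtTop v j k) := by
  rw [gtTop_eq, gtTop_eq, pow_succ']
  rfl

namespace IsHighest

variable {a b : ℕ} {v : V}

lemma h₁_gtTop (hv : IsHighest a b v) (j k : ℕ) :
    ⁅h₁, gtTop v j k⁆ = ((a : ℂ) + j - k) • gtTop v j k := by
  induction j with
  | zero =>
    induction k with
    | zero => simpa [gtTop_zero_zero] using hv.h₁_eq
    | succ k ih =>
      rw [gtTop_succ_right, h₁_lowering ih]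
      congr 1
      push_cast
      ring
  | succ j ih =>
    rw [gtTop_succ_left, h₁_f₂_apply, ih, lie_smul]
    push_cast
    module

lemma h₂_gtTop (hv : IsHighest a b v) (j k : ℕ) :
    ⁅h₂, gtTop v j k⁆ = ((b : ℂ) - 2 * j - k) • gtTop v j k := by
  induction j with
  | zero =>
    induction k with
    | zero => simpa [gtTop_zero_zero] using hv.h₂_eq
    | succ k ih =>
      rw [gtTop_succ_right, h₂_lowering ih (hv.h₁_gtTop 0 k)]
      congr 1
      push_cast
      ring
  | succ j ih =>
    rw [gtTop_succ_left, h₂_f₂_apply, ih, lie_smul]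
    push_cast
    module

lemma e₁_gtTop (hv : IsHighest a b v) (j k : ℕ) : ⁅e₁, gtTop v j k⁆ = 0 := by
  induction j with
  | zero =>
    induction k with
    | zero => exact hv.e₁_eq
    | succ k ih => rw [gtTop_succ_right, e₁_lowering ih (hv.h₁_gtTop 0 k)]
  | succ j ih => rw [gtTop_succ_left, e₁_f₂_apply, ih, lie_zero]

lemma gtTop_succ_right_eq (hv : IsHighest a b v) (j k : ℕ) :
    gtTop v j (k + 1) = ((a : ℂ) + j - k + 1) • ⁅f₃, gtTop v j k⁆ - ⁅f₁, gtTop v (j + 1) k⁆ := by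
  rw [gtTop_succ_right, lowering_of_h₁_eq (hv.h₁_gtTop j k), gtTop_succ_left]

lemma f₃_gtTop (hv : IsHighest a b v) {j k : ℕ} (hk : k ≤ a) :
    ⁅f₃, gtTop v j k⁆ =
      ((a : ℂ) + j - k + 1)⁻¹ • (gtTop v j (k + 1) + ⁅f₁, gtTop v (j + 1) k⁆) := by
  have hne : (a : ℂ) + j - k + 1 ≠ 0 := by
    obtain ⟨d, rfl⟩ := Nat.exists_eq_add_of_le hk
    have : ((d + j + 1 : ℕ) : ℂ) ≠ 0 := Nat.cast_ne_zero.2 (by lia)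
    push_cast at this ⊢
    convert this using 1
    ring
  rw [hv.gtTop_succ_right_eq, sub_add_cancel, smul_smul, inv_mul_cancel₀ hne, one_smul]

lemma e₂_gtTop_zero (hv : IsHighest a b v) (k : ℕ) :
    ⁅e₂, gtTop v 0 k⁆ = -((k : ℂ) * (a + b + 2 - k)) • ⁅f₁, gtTop v 0 (k - 1)⁆ := by
  induction k with
  | zero => simpa [gtTop_zero_zero] using hv.e₂_eq
  | succ k ih =>
    have h := hv.gtTop_succ_right_eq 0 k
    rw [h, gtTop_succ_left, lie_sub, lie_smul, e₂_f₃_apply, e₂_f₁_apply, e₂_f₂_apply,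
      hv.h₂_gtTop, ih, Nat.add_sub_cancel]
    cases k with
    | zero =>
      simp only [Nat.cast_zero, zero_mul, neg_zero, zero_smul, lie_zero, lie_add, lie_smul]
      push_cast
      module
    | succ k =>
      rw [Nat.add_sub_cancel]
      simp only [hv.gtTop_succ_right_eq 0 k, gtTop_succ_left, lie_add, lie_sub, lie_smul,
        f₃_f₁_apply, f₂_f₁_apply]
      push_cast
      module

/-- The only components of `e₂ (f₂ ^ j Z ^ k v)` are in the two neighbouring `𝔤𝔩₂`-constituents;
the coefficients are the Gelfand–Tsetlin ones. For `j = 0` or `k = 0` the term with a truncated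
index has coefficient `0`. -/
lemma e₂_gtTop (hv : IsHighest a b v) {j k : ℕ} (hk : k ≤ a) :
    ⁅e₂, gtTop v j k⁆ =
      ((j : ℂ) * (b - j + 1) * (a + j + 1) / (a + j - k + 1)) • gtTop v (j - 1) k
        - ((k : ℂ) * (a + b + 2 - k) * (a - k + 1) / (a + j - k + 1)) •
          ⁅f₁, gtTop v j (k - 1)⁆ := by
  have hne : ∀ j : ℕ, (a : ℂ) + j - k + 1 ≠ 0 := by
    intro j
    obtain ⟨d, rfl⟩ := Nat.exists_eq_add_of_le hk
    have : ((d + j + 1 : ℕ) : ℂ) ≠ 0 := Nat.cast_ne_zero.2 (by lia)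
    push_cast at this ⊢
    convert this using 1
    ring
  induction j with
  | zero =>
    have h0 := hne 0
    simp only [Nat.cast_zero, add_zero] at h0
    rw [hv.e₂_gtTop_zero]
    simp only [Nat.cast_zero, add_zero, zero_mul, zero_div, zero_smul, zero_sub]
    rw [mul_div_assoc, div_self h0, mul_one, neg_smul]
  | succ j ih =>
    have h0 := hne j
    have h1 := hne (j + 1)
    push_cast at h1
    rw [gtTop_succ_left, e₂_f₂_apply, ih, hv.h₂_gtTop, Nat.add_sub_cancel, lie_sub, lie_smul,
      lie_smul, ← gtTop_succ_left]
    -- the truncation `j - 1` is harmless because the coefficient vanishes at `j = 0`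
    have hA : ((j : ℂ) * (b - j + 1) * (a + j + 1) / (a + j - k + 1)) • gtTop v (j - 1 + 1) k =
        ((j : ℂ) * (b - j + 1) * (a + j + 1) / (a + j - k + 1)) • gtTop v j k := by
      cases j with
      | zero => simp
      | succ j => rw [Nat.add_sub_cancel]
    rw [hA]
    cases k with
    | zero =>
      simp only [Nat.cast_zero, zero_mul, zero_div, zero_smul, sub_zero, ← add_smul] at h0 h1 ⊢
      congr 1
      push_cast
      field_simp
      ring
    | succ k =>
      rw [Nat.add_sub_cancel, f₂_f₁_apply, ← gtTop_succ_left, hv.f₃_gtTop (by lia)]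
      have h2 : (a : ℂ) + j - k + 1 ≠ 0 := by
        push_cast at h1
        convert h1 using 1
        ring
      push_cast at h0 h1 ⊢
      match_scalars
      · field_simp
        ring
      · field_simp
        ring

lemma hasPrimitiveVectorWith (hv : IsHighest a b v) {j k : ℕ} (h : gtTop v j k ≠ 0) :
    isSl2Triple₁.HasPrimitiveVectorWith (gtTop v j k) ((a : ℂ) + j - k) where
  ne_zero := h
  lie_h := hv.h₁_gtTop j k
  lie_e := hv.e₁_gtTop j k

lemma gtTop_ne_zero (hv : IsHighest a b v) {j k : ℕ} (hj : j ≤ b) (hk : k ≤ a) :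
    gtTop v j k ≠ 0 := by
  induction k with
  | zero =>
    have P : isSl2Triple₂.HasPrimitiveVectorWith v (b : ℂ) := ⟨hv.ne_zero, hv.h₂_eq, hv.e₂_eq⟩
    exact P.pow_toEnd_f_ne_zero_of_eq_nat rfl hj
  | succ k ih =>
    intro h
    -- applying `e₁ e₂` returns a nonzero multiple of the preceding vector
    have h1 : ⁅e₁, ⁅e₂, gtTop v j (k + 1)⁆⁆ = 0 := by rw [h, lie_zero, lie_zero]
    rw [hv.e₂_gtTop hk, lie_sub, lie_smul, lie_smul, hv.e₁_gtTop, Nat.add_sub_cancel,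
      e₁_f₁_apply, hv.e₁_gtTop, lie_zero, zero_add, hv.h₁_gtTop, smul_zero, zero_sub,
      neg_eq_zero, smul_smul] at h1
    refine (smul_ne_zero ?_ (ih (by lia))) h1
    obtain ⟨d, rfl⟩ := Nat.exists_eq_add_of_le hk
    have e1 : ((k + 1 + d : ℕ) : ℂ) + b + 2 - (k + 1 : ℕ) = (d + b + 2 : ℕ) := by
      push_cast; ring
    have e2 : ((k + 1 + d : ℕ) : ℂ) - (k + 1 : ℕ) + 1 = (d + 1 : ℕ) := by push_cast; ring
    have e3 : ((k + 1 + d : ℕ) : ℂ) + j - (k + 1 : ℕ) + 1 = (d + j + 1 : ℕ) := by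
      push_cast; ring
    have e4 : ((k + 1 + d : ℕ) : ℂ) + j - k = (d + j + 1 : ℕ) := by push_cast; ring
    rw [e1, e2, e3, e4]
    have (n : ℕ) : ((n + 1 : ℕ) : ℂ) ≠ 0 := Nat.cast_ne_zero.2 (by lia)
    exact mul_ne_zero (div_ne_zero (mul_ne_zero (mul_ne_zero (this _) (this _)) (this _))
      (this _)) (this _)

end IsHighest

end HighestWeight

end TypeA2

/-! ### Joint eigenvectors -/

/-- Nonzero joint eigenvectors of a family of operators with pairwise distinct systems of
eigenvalues are linearly independent; the operators need not commute. -/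
lemma linearIndependent_of_joint_eigenvectors {K M ι κ : Type*} [Field K] [AddCommGroup M]
    [Module K M] {v : ι → M} (hv : ∀ i, v i ≠ 0) (T : κ → Module.End K M) {χ : ι → κ → K}
    (hχ : Function.Injective χ) (hT : ∀ i s, T s (v i) = χ i s • v i) :
    LinearIndependent K v := by
  classical
  rw [linearIndependent_iff']
  intro s
  induction s using Finset.induction with
  | empty => simp
  | insert i₀ s hi₀ ih =>
    intro c hc
    have hs : ∀ i ∈ s, c i = 0 := by
      intro i hi
      have hne : χ i ≠ χ i₀ := fun h ↦ hi₀ (hχ h ▸ hi)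
      obtain ⟨t, ht⟩ := Function.ne_iff.1 hne
      -- `T t - χ i₀ t` removes the `i₀`-th term and rescales the others
      have h := congrArg (T t - χ i₀ t • (1 : Module.End K M)) hc
      rw [map_sum, Finset.sum_insert hi₀, map_zero] at h
      have h' : ∑ i ∈ s, (c i * (χ i t - χ i₀ t)) • v i = 0 := by
        rw [← h]
        simp [hT, sub_smul, mul_smul, smul_sub]
      exact (mul_eq_zero.1 (ih _ h' i hi)).resolve_right (sub_ne_zero.2 ht)
    rw [Finset.sum_insert hi₀, Finset.sum_eq_zero fun i hi ↦ by rw [hs i hi, zero_smul],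
      add_zero, smul_eq_zero] at hc
    intro i hi
    rcases Finset.mem_insert.1 hi with rfl | hi
    · exact hc.resolve_right (hv i)
    · exact hs i hi

/-- The dimension of a joint eigenspace of operators that are diagonal in a common basis. -/
lemma finrank_joint_eigenspace {K M ι κ : Type*} [Field K] [AddCommGroup M] [Module K M]
    [Finite ι] (B : Module.Basis ι K M) (T : κ → Module.End K M) {χ : ι → κ → K}
    (hT : ∀ i s, T s (B i) = χ i s • B i) (c : κ → K) (W : Submodule K M)
    (hW : ∀ x, x ∈ W ↔ ∀ s, T s x = c s • x) :
    Module.finrank K W = Nat.card {i // χ i = c} := by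
  classical
  have := Fintype.ofFinite ι
  have hWspan : W = Submodule.span K (Set.range fun i : {i // χ i = c} ↦ B i) := by
    apply le_antisymm
    · intro x hx
      have hr : (Set.range fun i : {i // χ i = c} ↦ B i) = B '' {i | χ i = c} := by
        rw [← Set.range_domRestrict]
        rfl
      rw [hr, Module.Basis.mem_span_image]
      intro i hi
      funext s
      have hcoord : B.repr (T s x) i = χ i s * B.repr x i := by
        have h : B.coord i ∘ₗ T s = χ i s • B.coord i := B.ext fun j ↦ by
          by_cases hij : j = i
          · simp [hT, hij]
          · simp [hT, hij]
        exact LinearMap.congr_fun h x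
      rw [(hW x).1 hx s, map_smul, Finsupp.smul_apply, smul_eq_mul] at hcoord
      exact (mul_right_cancel₀ (Finsupp.mem_support_iff.1 hi) hcoord).symm
    · rw [Submodule.span_le]
      rintro _ ⟨⟨i, rfl⟩, rfl⟩
      exact (hW _).2 (hT i)
  have hB : LinearIndependent K fun i : {i // χ i = c} ↦ B i :=
    B.linearIndependent.comp _ Subtype.val_injective
  rw [hWspan, finrank_span_eq_card hB, Nat.card_eq_fintype_card]

namespace TypeA2

open LieModule (toEnd)

/-! ### The Gelfand–Tsetlin basis -/

section GelfandTsetlin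

variable {V : Type*} [AddCommGroup V] [Module ℂ V] [LieRingModule sl3 V] [LieModule ℂ sl3 V]

/-- The Gelfand–Tsetlin vector `f₁ ^ i f₂ ^ j Z ^ k v`, where `Z` is the Mickelsson operator; its
weight is that of `v` lowered by `(i + k) α₁ + (j + k) α₂`. -/
def gtVec (v : V) (i j k : ℕ) : V := (toEnd ℂ sl3 V f₁ ^ i) (gtTop v j k)

lemma f₁_gtVec (v : V) (i j k : ℕ) : ⁅f₁, gtVec v i j k⁆ = gtVec v (i + 1) j k := by
  rw [gtVec, gtVec, pow_succ']
  rfl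

lemma e₂_f₁_pow (i : ℕ) (u : V) :
    ⁅e₂, (toEnd ℂ sl3 V f₁ ^ i) u⁆ = (toEnd ℂ sl3 V f₁ ^ i) ⁅e₂, u⁆ := by
  induction i with
  | zero => rfl
  | succ i ih => simp [pow_succ', e₂_f₁_apply, ih]

lemma f₃_f₁_pow (i : ℕ) (u : V) :
    ⁅f₃, (toEnd ℂ sl3 V f₁ ^ i) u⁆ = (toEnd ℂ sl3 V f₁ ^ i) ⁅f₃, u⁆ := by
  induction i with
  | zero => rfl
  | succ i ih => simp [pow_succ', f₃_f₁_apply, ih]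

lemma f₂_f₁_pow (i : ℕ) (u : V) :
    ⁅f₂, (toEnd ℂ sl3 V f₁ ^ i) u⁆ =
      (toEnd ℂ sl3 V f₁ ^ i) ⁅f₂, u⁆ - (i : ℂ) • (toEnd ℂ sl3 V f₁ ^ (i - 1)) ⁅f₃, u⁆ := by
  induction i with
  | zero => simp
  | succ i ih =>
    have h : (i : ℂ) • ⁅f₁, (toEnd ℂ sl3 V f₁ ^ (i - 1)) ⁅f₃, u⁆⁆ =
        (i : ℂ) • (toEnd ℂ sl3 V f₁ ^ i) ⁅f₃, u⁆ := by
      cases i with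
      | zero => simp
      | succ i => simp [pow_succ']
    rw [pow_succ', Module.End.mul_apply, LieModule.toEnd_apply_apply, f₂_f₁_apply, ih, lie_sub,
      lie_smul, h, f₃_f₁_pow, Nat.add_sub_cancel]
    simp only [Module.End.mul_apply, LieModule.toEnd_apply_apply]
    push_cast
    module

lemma h₂_f₁_pow {n : ℂ} {u : V} (hu : ⁅h₂, u⁆ = n • u) (i : ℕ) :
    ⁅h₂, (toEnd ℂ sl3 V f₁ ^ i) u⁆ = (n + i) • (toEnd ℂ sl3 V f₁ ^ i) u := by
  induction i with
  | zero => simpa using hu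
  | succ i ih =>
    rw [pow_succ', Module.End.mul_apply, LieModule.toEnd_apply_apply, h₂_f₁_apply, ih, lie_smul]
    push_cast
    module

namespace IsHighest

variable {a b : ℕ} {v : V}

lemma h₁_gtVec (hv : IsHighest a b v) (i j k : ℕ) :
    ⁅h₁, gtVec v i j k⁆ = ((a : ℂ) + j - k - 2 * i) • gtVec v i j k := by
  by_cases h : gtTop v j k = 0
  · simp [gtVec, h]
  · exact (hv.hasPrimitiveVectorWith h).lie_h_pow_toEnd_f i

lemma h₂_gtVec (hv : IsHighest a b v) (i j k : ℕ) :
    ⁅h₂, gtVec v i j k⁆ = ((b : ℂ) - 2 * j - k + i) • gtVec v i j k :=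
  h₂_f₁_pow (hv.h₂_gtTop j k) i

lemma e₁_gtVec_zero (hv : IsHighest a b v) (j k : ℕ) : ⁅e₁, gtVec v 0 j k⁆ = 0 :=
  hv.e₁_gtTop j k

lemma e₁_gtVec_succ (hv : IsHighest a b v) (i j k : ℕ) :
    ⁅e₁, gtVec v (i + 1) j k⁆ = (((i : ℂ) + 1) * (a + j - k - i)) • gtVec v i j k := by
  by_cases h : gtTop v j k = 0
  · simp [gtVec, h]
  · exact (hv.hasPrimitiveVectorWith h).lie_e_pow_succ_toEnd_f i

lemma f₁_e₁_gtVec (hv : IsHighest a b v) (i j k : ℕ) :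
    ⁅f₁, ⁅e₁, gtVec v i j k⁆⁆ = ((i : ℂ) * (a + j - k - i + 1)) • gtVec v i j k := by
  cases i with
  | zero => simp [hv.e₁_gtVec_zero]
  | succ i =>
    rw [hv.e₁_gtVec_succ, lie_smul, f₁_gtVec]
    congr 1
    push_cast
    ring

lemma gtVec_ne_zero (hv : IsHighest a b v) {i j k : ℕ} (hj : j ≤ b) (hk : k ≤ a)
    (hi : i + k ≤ a + j) : gtVec v i j k ≠ 0 := by
  refine (hv.hasPrimitiveVectorWith (hv.gtTop_ne_zero hj hk)).pow_toEnd_f_ne_zero_of_eq_nat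
    (n := a + j - k) ?_ (by lia)
  rw [Nat.cast_sub (by lia), Nat.cast_add]

lemma gtVec_eq_zero_of_lt [FiniteDimensional ℂ V] (hv : IsHighest a b v) {i j k : ℕ}
    (hk : k ≤ a) (hi : a + j < i + k) : gtVec v i j k = 0 := by
  by_cases h : gtTop v j k = 0
  · simp [gtVec, h]
  have h0 := (hv.hasPrimitiveVectorWith h).pow_toEnd_f_eq_zero_of_eq_nat
    (n := a + j - k) (by rw [Nat.cast_sub (by lia), Nat.cast_add])
  obtain ⟨d, rfl⟩ : ∃ d, i = d + (a + j - k + 1) := ⟨i - (a + j - k + 1), by lia⟩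
  rw [gtVec, pow_add, Module.End.mul_apply, h0, map_zero]

lemma gtTop_eq_zero_of_left_lt [FiniteDimensional ℂ V] (hv : IsHighest a b v) {j k : ℕ}
    (hj : b < j) : gtTop v j k = 0 := by
  have P : isSl2Triple₂.HasPrimitiveVectorWith v (b : ℂ) := ⟨hv.ne_zero, hv.h₂_eq, hv.e₂_eq⟩
  obtain ⟨d, rfl⟩ : ∃ d, j = d + (b + 1) := ⟨j - (b + 1), by lia⟩
  rw [gtTop_eq, pow_add, Module.End.mul_apply, P.pow_toEnd_f_eq_zero_of_eq_nat rfl, map_zero,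
    map_zero]

/-- `Z ^ a v` has `h₁`-weight `0`, so that `f₁` kills it, and there `Z` acts as `-f₂ f₁`. -/
lemma gtTop_eq_zero_of_right_lt [FiniteDimensional ℂ V] (hv : IsHighest a b v) {j k : ℕ}
    (hk : a < k) : gtTop v j k = 0 := by
  have h0 : ⁅f₁, gtTop v 0 a⁆ = 0 :=
    hv.gtVec_eq_zero_of_lt (i := 1) (j := 0) (k := a) le_rfl (by lia)
  have h1 : gtTop v 0 (a + 1) = 0 := by
    rw [gtTop_succ_right, lowering_apply, hv.h₁_gtTop, lie_smul, f₃_apply, h0]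
    simp
  obtain ⟨d, rfl⟩ : ∃ d, k = d + (a + 1) := ⟨k - (a + 1), by lia⟩
  change (lowering ^ (a + 1)) v = 0 at h1
  rw [gtTop, pow_add, Module.End.mul_apply, h1, map_zero, map_zero]

lemma gtVec_eq_zero [FiniteDimensional ℂ V] (hv : IsHighest a b v) {i j k : ℕ}
    (h : ¬(j ≤ b ∧ k ≤ a ∧ i + k ≤ a + j)) : gtVec v i j k = 0 := by
  by_cases hj : j ≤ b
  · by_cases hk : k ≤ a
    · exact hv.gtVec_eq_zero_of_lt hk (by lia)
    · rw [gtVec, hv.gtTop_eq_zero_of_right_lt (not_le.1 hk), map_zero]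
  · rw [gtVec, hv.gtTop_eq_zero_of_left_lt (not_le.1 hj), map_zero]

end IsHighest

/-- The span of all Gelfand–Tsetlin vectors. -/
def gtSpan (v : V) : Submodule ℂ V :=
  Submodule.span ℂ (Set.range fun t : ℕ × ℕ × ℕ ↦ gtVec v t.1 t.2.1 t.2.2)

lemma gtVec_mem_gtSpan (v : V) (i j k : ℕ) : gtVec v i j k ∈ gtSpan v :=
  Submodule.subset_span ⟨(i, j, k), rfl⟩

lemma lie_mem_gtSpan {v : V} {X : sl3} (hX : ∀ i j k, ⁅X, gtVec v i j k⁆ ∈ gtSpan v) {u : V}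
    (hu : u ∈ gtSpan v) : ⁅X, u⁆ ∈ gtSpan v := by
  have h : gtSpan v ≤ (gtSpan v).comap (toEnd ℂ sl3 V X) := by
    conv_lhs => rw [gtSpan]
    rw [Submodule.span_le]
    rintro _ ⟨t, rfl⟩
    exact hX _ _ _
  exact h hu

namespace IsHighest

variable {a b : ℕ} {v : V}

lemma e₁_mem_gtSpan (hv : IsHighest a b v) {u : V} (hu : u ∈ gtSpan v) :
    ⁅e₁, u⁆ ∈ gtSpan v := by
  refine lie_mem_gtSpan (fun i j k ↦ ?_) hu
  cases i with
  | zero => simp [hv.e₁_gtVec_zero]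
  | succ i =>
    rw [hv.e₁_gtVec_succ]
    exact Submodule.smul_mem _ _ (gtVec_mem_gtSpan _ _ _ _)

lemma e₂_mem_gtSpan [FiniteDimensional ℂ V] (hv : IsHighest a b v) {u : V}
    (hu : u ∈ gtSpan v) : ⁅e₂, u⁆ ∈ gtSpan v := by
  refine lie_mem_gtSpan (fun i j k ↦ ?_) hu
  by_cases hk : k ≤ a
  · rw [gtVec, e₂_f₁_pow, hv.e₂_gtTop hk, map_sub, map_smul, map_smul]
    refine Submodule.sub_mem _ (Submodule.smul_mem _ _ (gtVec_mem_gtSpan _ _ _ _))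
      (Submodule.smul_mem _ _ ?_)
    exact gtVec_mem_gtSpan v (i + 1) j (k - 1)
  · rw [hv.gtVec_eq_zero (by tauto), lie_zero]
    exact zero_mem _

lemma f₂_mem_gtSpan [FiniteDimensional ℂ V] (hv : IsHighest a b v) {u : V}
    (hu : u ∈ gtSpan v) : ⁅f₂, u⁆ ∈ gtSpan v := by
  refine lie_mem_gtSpan (fun i j k ↦ ?_) hu
  by_cases hk : k ≤ a
  · rw [gtVec, f₂_f₁_pow, ← gtTop_succ_left, hv.f₃_gtTop hk, map_smul, map_add]
    refine Submodule.sub_mem _ (gtVec_mem_gtSpan _ _ _ _)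
      (Submodule.smul_mem _ _ (Submodule.smul_mem _ _ (Submodule.add_mem _
        (gtVec_mem_gtSpan _ _ _ _) ?_)))
    exact gtVec_mem_gtSpan v (i - 1 + 1) (j + 1) k
  · rw [hv.gtVec_eq_zero (by tauto), lie_zero]
    exact zero_mem _

lemma lie_mem_gtSpan [FiniteDimensional ℂ V] (hv : IsHighest a b v) (X : sl3) {u : V}
    (hu : u ∈ gtSpan v) : ⁅X, u⁆ ∈ gtSpan v := by
  have he₁ {w : V} : w ∈ gtSpan v → ⁅e₁, w⁆ ∈ gtSpan v := hv.e₁_mem_gtSpan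
  have he₂ {w : V} : w ∈ gtSpan v → ⁅e₂, w⁆ ∈ gtSpan v := hv.e₂_mem_gtSpan
  have hf₁ {w : V} : w ∈ gtSpan v → ⁅f₁, w⁆ ∈ gtSpan v :=
    TypeA2.lie_mem_gtSpan fun i j k ↦ f₁_gtVec v i j k ▸ gtVec_mem_gtSpan _ _ _ _
  have hf₂ {w : V} : w ∈ gtSpan v → ⁅f₂, w⁆ ∈ gtSpan v := hv.f₂_mem_gtSpan
  have hlie {X Y : sl3} (hX : ∀ {w : V}, w ∈ gtSpan v → ⁅X, w⁆ ∈ gtSpan v)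
      (hY : ∀ {w : V}, w ∈ gtSpan v → ⁅Y, w⁆ ∈ gtSpan v) : ⁅⁅X, Y⁆, u⁆ ∈ gtSpan v := by
    rw [lie_lie]
    exact Submodule.sub_mem _ (hX (hY hu)) (hY (hX hu))
  rw [eq_chevalley X]
  simp only [add_lie, sub_lie, smul_lie]
  have hs {w : V} (c : ℂ) (hw : w ∈ gtSpan v) : c • w ∈ gtSpan v := Submodule.smul_mem _ c hw
  exact add_mem (add_mem (sub_mem (add_mem (add_mem (add_mem (add_mem (hs _ (he₁ hu))
    (hs _ (he₂ hu))) (hs _ (hlie he₁ he₂))) (hs _ (hf₁ hu))) (hs _ (hf₂ hu)))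
    (hs _ (hlie hf₁ hf₂))) (hs _ (hlie he₁ hf₁))) (hs _ (hlie he₂ hf₂))

lemma gtSpan_eq_top [FiniteDimensional ℂ V] [LieModule.IsIrreducible ℂ sl3 V]
    (hv : IsHighest a b v) : gtSpan v = ⊤ := by
  let N : LieSubmodule ℂ sl3 V := { gtSpan v with lie_mem := fun {X _} hu ↦ hv.lie_mem_gtSpan X hu }
  have hN : N ≠ ⊥ := by
    intro h
    have hmem : v ∈ N := gtVec_mem_gtSpan v 0 0 0
    rw [h, LieSubmodule.mem_bot] at hmem
    exact hv.ne_zero hmem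
  exact congrArg LieSubmodule.toSubmodule ((eq_bot_or_eq_top N).resolve_left hN)

end IsHighest

/-- The Gelfand–Tsetlin patterns with top row `(a + b, b, 0)`, encoded by the exponents
`(i, j, k)` of `f₁ ^ i f₂ ^ j Z ^ k`: the second row is `(a + b - k, b - j)` and the third one
is `a + b - k - i`. -/
def gtPatterns (a b : ℕ) : Set (ℕ × ℕ × ℕ) :=
  {t | t.2.1 ≤ b ∧ t.2.2 ≤ a ∧ t.1 + t.2.2 ≤ a + t.2.1}

lemma finite_gtPatterns (a b : ℕ) : (gtPatterns a b).Finite := by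
  refine (Set.finite_Iic ((a + b, b, a) : ℕ × ℕ × ℕ)).subset ?_
  rintro ⟨i, j, k⟩ ⟨h1, h2, h3⟩
  refine ⟨?_, h1, h2⟩
  dsimp only at *
  lia

/-- The eigenvalues of `h₁`, `h₂` and `f₁ e₁` on a Gelfand–Tsetlin vector. -/
def gtEigenvalue (a b : ℕ) (t : ℕ × ℕ × ℕ) : Fin 3 → ℂ :=
  ![(a : ℂ) + t.2.1 - t.2.2 - 2 * t.1, (b : ℂ) - 2 * t.2.1 - t.2.2 + t.1,
    (t.1 : ℂ) * (a + t.2.1 - t.2.2 - t.1 + 1)]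

lemma gtEigenvalue_injOn (a b : ℕ) : Set.InjOn (gtEigenvalue a b) (gtPatterns a b) := by
  rintro ⟨i, j, k⟩ ⟨h1, h2, h3⟩ ⟨i', j', k'⟩ ⟨h1', h2', h3'⟩ h
  have e1 : (a : ℂ) + j - k - 2 * i = a + j' - k' - 2 * i' := congrFun h 0
  have e2 : (b : ℂ) - 2 * j - k + i = b - 2 * j' - k' + i' := congrFun h 1
  have e3 : (i : ℂ) * (a + j - k - i + 1) = i' * (a + j' - k' - i' + 1) := congrFun h 2
  dsimp only at h1 h2 h3 h1' h2' h3'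
  have e1' : (a : ℤ) + j - k - 2 * i = a + j' - k' - 2 * i' := by exact_mod_cast e1
  have e2' : (b : ℤ) - 2 * j - k + i = b - 2 * j' - k' + i' := by exact_mod_cast e2
  have e3' : (i : ℤ) * (a + j - k - i + 1) = i' * (a + j' - k' - i' + 1) := by exact_mod_cast e3
  have hi : (i' : ℤ) = i + k - k' := by lia
  have hj : (j' : ℤ) = j + k - k' := by lia
  -- the eigenvalue of `f₁ e₁` separates the patterns of a given weight: the second factor is
  -- positive, since `k ≤ i + k` and `i' + k' ≤ a + j'`
  have hk : ((k' : ℤ) - k) * (a + j + 1 - k') = 0 := by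
    rw [hi, hj] at e3'
    linear_combination e3'
  rcases mul_eq_zero.1 hk with h0 | h0
  · obtain rfl : k = k' := by lia
    obtain rfl : i = i' := by lia
    obtain rfl : j = j' := by lia
    rfl
  · lia

/-- The Gelfand–Tsetlin basis of an irreducible module with highest weight vector `v`. -/
lemma IsHighest.exists_basis [FiniteDimensional ℂ V] [LieModule.IsIrreducible ℂ sl3 V]
    {a b : ℕ} {v : V} (hv : IsHighest a b v) :
    ∃ B : Module.Basis (gtPatterns a b) ℂ V,
      ∀ t, B t = gtVec v t.val.1 t.val.2.1 t.val.2.2 := by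
  have hli : LinearIndependent ℂ
      fun t : gtPatterns a b ↦ gtVec v t.val.1 t.val.2.1 t.val.2.2 := by
    refine linearIndependent_of_joint_eigenvectors
      (fun t ↦ hv.gtVec_ne_zero t.2.1 t.2.2.1 t.2.2.2)
      ![toEnd ℂ sl3 V h₁, toEnd ℂ sl3 V h₂, toEnd ℂ sl3 V f₁ * toEnd ℂ sl3 V e₁]
      (gtEigenvalue_injOn a b).injective fun t s ↦ ?_
    fin_cases s
    · exact hv.h₁_gtVec _ _ _
    · exact hv.h₂_gtVec _ _ _
    · exact hv.f₁_e₁_gtVec _ _ _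
  refine ⟨Module.Basis.mk hli ?_, fun t ↦ Module.Basis.mk_apply _ _ t⟩
  rw [← hv.gtSpan_eq_top, gtSpan, Submodule.span_le]
  rintro _ ⟨⟨i, j, k⟩, rfl⟩
  by_cases ht : (i, j, k) ∈ gtPatterns a b
  · exact Submodule.subset_span ⟨⟨_, ht⟩, rfl⟩
  · dsimp only
    rw [hv.gtVec_eq_zero ht]
    exact zero_mem _

/-! ### Counting patterns of a given weight -/

/-- The multiplicity of `x ω₁ + y ω₂` is the number of patterns of that weight. -/
lemma IsHighest.multiplicity_eq [FiniteDimensional ℂ V] [LieModule.IsIrreducible ℂ sl3 V]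
    {a b : ℕ} {v : V} (hv : IsHighest a b v) (x y : ℕ) :
    multiplicity V (wt x y) =
      {t ∈ gtPatterns a b | (a : ℤ) + t.2.1 - t.2.2 - 2 * t.1 = x ∧
        (b : ℤ) - 2 * t.2.1 - t.2.2 + t.1 = y}.ncard := by
  obtain ⟨B, hB⟩ := hv.exists_basis
  have := (finite_gtPatterns a b).to_subtype
  have h := finrank_joint_eigenspace B ![toEnd ℂ sl3 V h₁, toEnd ℂ sl3 V h₂]
    (χ := fun t ↦ ![(a : ℂ) + t.val.2.1 - t.val.2.2 - 2 * t.val.1,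
      (b : ℂ) - 2 * t.val.2.1 - t.val.2.2 + t.val.1])
    (fun t s ↦ by
      rw [hB]
      fin_cases s
      · exact hv.h₁_gtVec _ _ _
      · exact hv.h₂_gtVec _ _ _)
    ![(x : ℂ), (y : ℂ)] (LieModule.weightSpace V (wt x y : cartan → ℂ)).toSubmodule
    (fun u ↦ by
      rw [LieSubmodule.mem_toSubmodule, mem_weightSpace_wt, Fin.forall_fin_two]
      rfl)
  refine h.trans ?_
  rw [← Nat.card_coe_set_eq]
  refine Nat.card_congr ((Equiv.subtypeSubtypeEquivSubtypeInter (· ∈ gtPatterns a b)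
    fun t ↦ ![(a : ℂ) + t.2.1 - t.2.2 - 2 * t.1, (b : ℂ) - 2 * t.2.1 - t.2.2 + t.1] =
      ![(x : ℂ), (y : ℂ)]).trans
    (Equiv.subtypeEquivRight fun t ↦ and_congr_right fun _ ↦ ?_))
  rw [funext_iff, Fin.forall_fin_two]
  refine and_congr ?_ ?_
  · change (a : ℂ) + t.2.1 - t.2.2 - 2 * t.1 = x ↔ _
    norm_cast
  · change (b : ℂ) - 2 * t.2.1 - t.2.2 + t.1 = y ↔ _
    norm_cast

/-- A pattern whose weight is lower than the highest one by `p α₁ + q α₂` is determined by its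
last entry `k`, which runs through an interval. -/
lemma ncard_gtPatterns {a b x y : ℕ} {p q : ℤ} (hp : (a : ℤ) + q - 2 * p = x)
    (hq : (b : ℤ) + p - 2 * q = y) :
    ({t ∈ gtPatterns a b | (a : ℤ) + t.2.1 - t.2.2 - 2 * t.1 = x ∧
        (b : ℤ) - 2 * t.2.1 - t.2.2 + t.1 = y}.ncard : ℤ) =
      max 0 (min (min (q + 1) (p + 1)) (min ((a : ℤ) + 1) ((b : ℤ) + 1))) := by
  have himage : {t ∈ gtPatterns a b | (a : ℤ) + t.2.1 - t.2.2 - 2 * t.1 = x ∧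
        (b : ℤ) - 2 * t.2.1 - t.2.2 + t.1 = y} =
      (fun k : ℤ ↦ ((p - k).toNat, (q - k).toNat, k.toNat)) ''
        (Finset.Icc (max 0 (q - b)) (min (a : ℤ) (min p q)) : Set ℤ) := by
    ext ⟨i, j, k⟩
    simp only [gtPatterns, Set.mem_ofPred_eq, Set.mem_image, Finset.coe_Icc, Set.mem_Icc,
      Prod.mk.injEq]
    constructor
    · rintro ⟨⟨h1, h2, h3⟩, h4, h5⟩
      exact ⟨k, by lia, by lia, by lia, by lia⟩
    · rintro ⟨l, ⟨h1, h2⟩, h3, h4, h5⟩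
      refine ⟨⟨?_, ?_, ?_⟩, ?_, ?_⟩ <;> lia
  rw [himage, Set.InjOn.ncard_image, Set.ncard_coe_finset, Int.card_Icc]
  · lia
  · intro k hk l hl h
    simp only [Finset.coe_Icc, Set.mem_Icc, Prod.mk.injEq] at hk hl h
    lia

end GelfandTsetlin

lemma wt_sub_wt_mem_rootLattice {a b x y : ℕ} {p q : ℤ} (hp : (a : ℤ) + q - 2 * p = x)
    (hq : (b : ℤ) + p - 2 * q = y) : wt a b - wt x y ∈ rootLattice := by
  have h : wt a b - wt x y = p • α₁ + q • α₂ := by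
    have hp' : (a : ℂ) + q - 2 * p = x := by exact_mod_cast hp
    have hq' : (b : ℂ) + p - 2 * q = y := by exact_mod_cast hq
    simp only [wt, ω₁, ω₂, ← Nat.cast_smul_eq_nsmul ℂ, ← Int.cast_smul_eq_zsmul ℂ, ← hp', ← hq']
    module
  rw [h]
  exact add_mem (zsmul_mem (AddSubgroup.subset_closure (by simp)) _)
    (zsmul_mem (AddSubgroup.subset_closure (by simp)) _)

lemma HasHighestWeight.exists_isHighest {V : Type*} [AddCommGroup V] [Module ℂ V]
    [LieRingModule sl3 V] [LieModule ℂ sl3 V] {a b : ℕ} (h : HasHighestWeight V (wt a b)) :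
    ∃ v : V, IsHighest a b v := by
  obtain ⟨v, h0, hw, he⟩ := h
  rw [mem_weightSpace_wt] at hw
  exact ⟨v, h0, he 0 1 (by decide), he 1 2 (by decide), hw.1, hw.2⟩

end TypeA2

end

theorem mainTheorem2 (a b x y : ℕ)
    (hdvd : (3 : ℤ) ∣ (a : ℤ) + 2 * b - x - 2 * y)
    (V : Type*) [AddCommGroup V] [Module ℂ V] [LieRingModule TypeA2.sl3 V]
    [LieModule ℂ TypeA2.sl3 V] [FiniteDimensional ℂ V]
    [LieModule.IsIrreducible ℂ TypeA2.sl3 V]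
    (hV : TypeA2.HasHighestWeight V (TypeA2.wt a b)) :
    TypeA2.wt a b - TypeA2.wt x y ∈ TypeA2.rootLattice ∧
    (TypeA2.multiplicity V (TypeA2.wt x y) : ℚ) =
      max 0 (min (min (((a : ℚ) + 2 * b - x - 2 * y) / 3 + 1)
                      ((2 * (a : ℚ) + b - 2 * x - y) / 3 + 1))
                 (min ((a : ℚ) + 1) ((b : ℚ) + 1))) := by
  obtain ⟨q, hq⟩ := hdvd
  -- `p` and `q` are the coefficients of the simple roots in the difference of the two weights
  obtain ⟨p, hp⟩ : ∃ p : ℤ, 2 * (a : ℤ) + b - 2 * x - y = 3 * p :=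
    ⟨2 * q - b + y, by lia⟩
  have hx : (a : ℤ) + q - 2 * p = x := by lia
  have hy : (b : ℤ) + p - 2 * q = y := by lia
  refine ⟨TypeA2.wt_sub_wt_mem_rootLattice hx hy, ?_⟩
  obtain ⟨v, hv⟩ := hV.exists_isHighest
  have hq' : ((a : ℚ) + 2 * b - x - 2 * y) / 3 = q := by
    have : (a : ℚ) + 2 * b - x - 2 * y = 3 * q := by exact_mod_cast hq
    rw [this]
    ring
  have hp' : (2 * (a : ℚ) + b - 2 * x - y) / 3 = p := by
    have : 2 * (a : ℚ) + b - 2 * x - y = 3 * p := by exact_mod_cast hp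
    rw [this]
    ring
  rw [hv.multiplicity_eq, hq', hp']
  exact_mod_cast TypeA2.ncard_gtPatterns hx hy
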